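/- Model (semi-synchronous model SSM with multiplicity detection). There are $n$ robots, points of the Euclidean plane, several of which may be at the same position. Each robot has its own coordinate system, centred at its current position, with arbitrary fixed axes (no common orientation or handedness) and an arbitrary unit of length. Its \emph{view} consists, in these coordinates, of the set of occupied positions and the set of those occupied by more than one robot. A \emph{protocol}, the same for all robots, maps the current view and the value of $\mathrm{Random}()$, uniform on $\{0,1\}$, to a destination in local coordinates; it has no memory, no identities and is not given $n$. It is a \emph{deterministic algorithm} if it does not use $\mathrm{Random}()$. At each time $t=0,1,2,\dots$ a scheduler activates a non-empty set of robots, which may depend on the whole past (and on randomness of the scheduler), such that almost surely every robot is activated infinitely often; given the past and the activated set, the values of $\mathrm{Random}()$ at time $t$ are independent and uniform. Each active robot $r$ simultaneously computes its destination from its view and moves to it if its distance is at most $\sigma_r$, and otherwise moves towards it by $\sigma_r$, where $\sigma_r>0$ is fixed and unknown to the robots; inactive robots do not move. A protocol is a \emph{self-stabilizing protocol for the Gathering Problem with probability $1$} for $n$ robots if, for every initial configuration (positions may coincide), all coordinate systems, all bounds $\sigma_r$ and every such scheduler, almost surely all robots are at one common point from some time on, and whenever all robots are at one point they remain there. Procedures.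 The Voronoi cell of an occupied position $p$ is the set of points strictly closer to $p$ than to every other occupied position. Procedure $SP$: if $\mathrm{Random}()=0$, move toward a chosen point of the Voronoi cell of the robot's own position, different from that position; otherwise do not move. Procedure $SSA_{GP}$, for a deterministic algorithm $A_{GP}$: if at least two positions hold more than one robot, execute $SP$; otherwise execute $A_{GP}$. Theorem. There is a protocol that, for every $n\ge 2$, is a self-stabilizing protocol for the Gathering Problem in SSM with multiplicity detection with probability $1$. It can be chosen such that (i) for $n=2$, an active robot moves toward the position of the other robot with probability $1/2$ and otherwise does not move; (ii) for $n\ge 3$, it is Procedure $SSA_{GP}$ with some choice of points in $SP$ and some deterministic algorithm $A_{GP}$ which, for every $n\ge3$, all coordinate systems and all bounds $\sigma_r$, gathers the robots at one point in finite time, where they remain, from every initial configuration with pairwise distinct positions and under every fair schedule. -/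

import Mathlib

namespace Robots

noncomputable section

open MeasureTheory

open scoped Classical

/-- The Euclidean plane. -/
abbrev Plane := EuclideanSpace ℝ (Fin 2)

/-- A configuration of `n` robots: the position of each of them (positions may coincide). -/
abbrev Config (n : ℕ) := Fin n → Plane

/-- A robot's own coordinate system: its axes (orientation and handedness are arbitrary) and the
length of its unit. The origin is the current position of the robot. -/
structure Frame where
  axes : Plane ≃ₗᵢ[ℝ] Plane
  unit : ℝ
  unit_pos : 0 < unit

/-- The coordinates of the point `q` for a robot located at `p`. -/
def Frame.toLocal (F : Frame) (p q : Plane) : Plane := F.unit⁻¹ • F.axes (q - p)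

/-- The point of the plane with coordinates `x` for a robot located at `p`. -/
def Frame.toGlobal (F : Frame) (p x : Plane) : Plane := p + F.unit • F.axes.symm x

/-- What a robot with multiplicity detection sees, in its own coordinates (so that the robot itself
is at `0`): the occupied positions, and those among them that hold more than one robot. -/
structure View where
  occupied : Finset Plane
  multiple : Finset Plane

/-- The view of the robot `i` in the configuration `p`. -/
def view {n : ℕ} (F : Frame) (p : Config n) (i : Fin n) : View where
  occupied := Finset.univ.image fun j => F.toLocal (p i) (p j)
  multiple := (Finset.univ.image fun j => F.toLocal (p i) (p j)).filter fun x =>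
    1 < (Finset.univ.filter fun j => F.toLocal (p i) (p j) = x).card

/-- A deterministic algorithm (uniform, anonymous, oblivious): the destination, in local
coordinates, as a function of the current view only. -/
abbrev DetAlgorithm := View → Plane

/-- A randomized protocol (uniform, anonymous, oblivious): the destination, in local coordinates,
as a function of the current view and of the value of `Random()`, uniform on `{0, 1}`.
It is not told the number of robots. -/
abbrev Protocol := View → Fin 2 → Plane

/-- A deterministic algorithm as a protocol that ignores its coin. -/
def DetAlgorithm.toProtocol (A : DetAlgorithm) : Protocol := fun v _ => A v

/-- A move from `p` towards `q` of length at most `s`. -/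
def moveToward (s : ℝ) (p q : Plane) : Plane :=
  if dist p q ≤ s then q else p + (s / dist p q) • (q - p)

/-- One computation step: the active robots (the set `act`) look, compute and move
simultaneously, the others stay where they are. -/
def step {n : ℕ} (P : Protocol) (F : Fin n → Frame) (σ : Fin n → ℝ)
    (act : Finset (Fin n)) (coin : Fin n → Fin 2) (p : Config n) : Config n := fun i =>
  if i ∈ act then
    moveToward (σ i) (p i) ((F i).toGlobal (p i) (P (view (F i) p i) (coin i)))
  else p i

/-- The configuration at time `t`, from the initial configuration `p₀`, when the scheduler
activates `act s` and the robots draw `coin s` at time `s`. -/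
def run {n : ℕ} (P : Protocol) (F : Fin n → Frame) (σ : Fin n → ℝ) (p₀ : Config n)
    (act : ℕ → Finset (Fin n)) (coin : ℕ → Fin n → Fin 2) : ℕ → Config n
  | 0 => p₀
  | t + 1 => step P F σ (act t) (coin t) (run P F σ p₀ act coin t)

/-- All the robots are at the point `x`. -/
def GatheredAt {n : ℕ} (p : Config n) (x : Plane) : Prop := ∀ i, p i = x

/-- Every robot is activated infinitely often. -/
def IsFair {n : ℕ} (act : ℕ → Finset (Fin n)) : Prop := ∀ i, ∀ t, ∃ s, t ≤ s ∧ i ∈ act s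

/-- A scheduler together with the coins of the robots, on a probability space. The activated sets
are non-empty, almost surely fair, and may depend on everything that happened before (and on
randomness of the scheduler); the coins drawn at time `t` are independent and uniform given that
past, which includes the choice of the set activated at time `t`. -/
structure RandomSchedule {Ω : Type} [m : MeasurableSpace Ω] (μ : Measure Ω) (n : ℕ) where
  past : Filtration ℕ m
  act : ℕ → Ω → Finset (Fin n)
  coin : ℕ → Ω → Fin n → Fin 2
  act_measurable : ∀ t (s : Finset (Fin n)), MeasurableSet[past t] {ω | act t ω = s}
  coin_measurable : ∀ t (c : Fin n → Fin 2), MeasurableSet[past (t + 1)] {ω | coin t ω = c}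
  coin_uniform : ∀ t (c : Fin n → Fin 2) (E : Set Ω), MeasurableSet[past t] E →
    μ ({ω | coin t ω = c} ∩ E) = (2⁻¹ : ENNReal) ^ n * μ E
  act_nonempty : ∀ t ω, (act t ω).Nonempty
  act_fair : ∀ᵐ ω ∂μ, IsFair fun t => act t ω

/-- `P` is a self-stabilizing protocol for gathering `n` robots with probability 1: from every
initial configuration, whatever the coordinate systems, the travel bounds and the fair scheduler,
almost surely the robots are all at one same point from some time on (convergence), and once
gathered at a point they stay there (closure). -/
def SelfStabilizingGathering (n : ℕ) (P : Protocol) : Prop :=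
  ∀ (F : Fin n → Frame) (σ : Fin n → ℝ), (∀ i, 0 < σ i) → ∀ p₀ : Config n,
  ∀ (Ω : Type) [MeasurableSpace Ω] (μ : Measure Ω) [IsProbabilityMeasure μ]
    (S : RandomSchedule μ n), ∀ᵐ ω ∂μ,
      (∃ (T : ℕ) (x : Plane), ∀ t, T ≤ t →
        GatheredAt (run P F σ p₀ (fun s => S.act s ω) (fun s => S.coin s ω) t) x) ∧
      (∀ (t : ℕ) (x : Plane),
        GatheredAt (run P F σ p₀ (fun s => S.act s ω) (fun s => S.coin s ω) t) x →
        GatheredAt (run P F σ p₀ (fun s => S.act s ω) (fun s => S.coin s ω) (t + 1)) x)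

/-- `A` deterministically gathers `n` robots from every initial configuration without two robots at
the same position, under every fair scheduler. -/
def DetGatheringFromDistinct (n : ℕ) (A : DetAlgorithm) : Prop :=
  ∀ (F : Fin n → Frame) (σ : Fin n → ℝ), (∀ i, 0 < σ i) →
  ∀ p₀ : Config n, Function.Injective p₀ →
  ∀ (act : ℕ → Finset (Fin n)) (coin : ℕ → Fin n → Fin 2),
    (∀ t, (act t).Nonempty) → IsFair act →
    ∃ (T : ℕ) (x : Plane), ∀ t, T ≤ t → GatheredAt (run A.toProtocol F σ p₀ act coin t) x

/-- The (open) Voronoi cell of `p` in the diagram of the set `S`. -/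
def voronoiCell (S : Finset Plane) (p : Plane) : Set Plane :=
  {q | ∀ p' ∈ S, p' ≠ p → dist q p < dist q p'}

/-- A choice of a position in the robot's own Voronoi cell, different from its current one. -/
def IsCellChoice (c : View → Plane) : Prop :=
  ∀ v, c v ∈ voronoiCell v.occupied 0 ∧ c v ≠ 0

/-- Procedure `SP` (scattering), with the choice `c` of the position in the Voronoi cell. -/
def procSP (c : View → Plane) : Protocol := fun v r => if r = 0 then c v else 0

/-- Procedure `SSA_GP`: scatter if at least two positions hold more than one robot, and execute
the deterministic algorithm `A` otherwise. -/
def procSSAGP (c : View → Plane) (A : DetAlgorithm) : Protocol := fun v r =>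
  if 2 ≤ v.multiple.card then procSP c v r else A v

/-- The position of the other robot, in a view of two robots (`0` if they are together). -/
def otherPosition (v : View) : Plane :=
  if h : ∃ x ∈ v.occupied, x ≠ 0 then h.choose else 0

/-- The routine for two robots: go to the other robot's position with probability `1/2`. -/
def procPair : Protocol := fun v r => if r = 0 then otherPosition v else 0

/-- With `n` robots, the protocols `P` and `Q` behave in the same way. -/
def SameBehaviour (n : ℕ) (P Q : Protocol) : Prop :=
  ∀ (F : Frame) (p : Config n) (i : Fin n) (r : Fin 2), P (view F p i) r = Q (view F p i) r

end

end Robots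

/-!
Call *pole* the multiple position, if there is exactly one, and otherwise the strict geometric
median of the distinct positions, if there is one. When only the robots closest to the pole move,
and move toward it, it stays the pole, so that they all arrive there. Distinct positions without a
strict median lie on a line and at least two robots are strictly between others; hence, as soon as
an end of the line moves off perpendicularly, the robots are no longer collinear and have a pole.

In the random case, a potential with values in a well-founded order (the set of pairs of coinciding
robots, or the number of moves by which two robots can meet) never increases. If it could be
decreased infinitely often by suitable coins, then it would decrease infinitely often, by Lévy's
conditional Borel-Cantelli lemma, as any given coins have conditional probability `2⁻ⁿ`.
-/

namespace Robots

noncomputable section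

open MeasureTheory Filter

/-! ### Sequences -/

theorem eventually_succ_eq_of_eventually_succ_le {α : Type*} [PartialOrder α] [WellFoundedLT α]
    {Φ : ℕ → α} (h : ∀ᶠ t in atTop, Φ (t + 1) ≤ Φ t) : ∀ᶠ t in atTop, Φ (t + 1) = Φ t := by
  obtain ⟨T, hT⟩ := eventually_atTop.1 h
  have hanti : Antitone fun t => Φ (T + t) := antitone_nat_of_succ_le fun t => hT (T + t) (by omega)
  obtain ⟨m, hm⟩ := WellFoundedLT.antitone_chain_condition hanti
  refine eventually_atTop.2 ⟨T + m, fun t ht => ?_⟩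
  obtain ⟨k, rfl⟩ := Nat.exists_eq_add_of_le ((Nat.le_add_right T m).trans ht)
  exact (hm (k + 1) (by omega)).symm.trans (hm k (by omega))

theorem IsFair.frequently {n : ℕ} {act : ℕ → Finset (Fin n)} (h : IsFair act) (i : Fin n) :
    ∃ᶠ t in atTop, i ∈ act t :=
  frequently_atTop.2 (h i)

theorem IsFair.frequently_exists_active_eq {n : ℕ} {α : Type*} {act : ℕ → Finset (Fin n)}
    (h : IsFair act) {q : ℕ → Fin n → α} (hidle : ∀ t, ∀ i ∉ act t, q (t + 1) i = q t i)
    (hq : ∃ᶠ t in atTop, ¬ Function.Injective (q t)) :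
    ∃ᶠ t in atTop, ∃ i ∈ act t, ∃ j ≠ i, q t j = q t i := by
  by_contra! hnot
  obtain ⟨T, hT⟩ := eventually_atTop.1 hnot
  obtain ⟨t₀, ht₀, hinj⟩ := frequently_atTop.1 hq T
  simp only [Function.Injective, not_forall] at hinj
  obtain ⟨i, j, hij, hne⟩ := hinj
  have hstill : ∀ t, t₀ ≤ t → q t i = q t j := fun t ht => by
    induction t, ht using Nat.le_induction with
    | base => exact hij
    | succ t ht ih =>
      rw [hidle t i fun hi => hT t (ht₀.trans ht) i hi j (Ne.symm hne) ih.symm,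
        hidle t j fun hj => hT t (ht₀.trans ht) j hj i hne ih, ih]
  obtain ⟨t, ht, hi⟩ := h i t₀
  exact hT t (ht₀.trans ht) i hi j (Ne.symm hne) (hstill t ht).symm

/-! ### Local coordinates and views -/

namespace Frame

variable (F : Frame) (p q q' x : Plane)

theorem toGlobal_toLocal : F.toGlobal p (F.toLocal p q) = q := by
  simp [toGlobal, toLocal, smul_smul, F.unit_pos.ne']

theorem toLocal_toGlobal : F.toLocal p (F.toGlobal p x) = x := by
  simp [toGlobal, toLocal, smul_smul, F.unit_pos.ne']

theorem toLocal_injective : Function.Injective (F.toLocal p) :=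
  Function.LeftInverse.injective (F.toGlobal_toLocal p)

theorem toLocal_surjective : Function.Surjective (F.toLocal p) :=
  Function.RightInverse.surjective (F.toLocal_toGlobal p)

theorem toLocal_self : F.toLocal p p = 0 := by
  simp [toLocal]

theorem toGlobal_zero : F.toGlobal p 0 = p := by
  simp [toGlobal]

theorem dist_toLocal : dist (F.toLocal p q) (F.toLocal p q') = F.unit⁻¹ * dist q q' := by
  rw [toLocal, toLocal, dist_smul₀, F.axes.dist_map, dist_sub_right,
    Real.norm_of_nonneg (inv_nonneg.2 F.unit_pos.le)]

theorem inner_toLocal :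
    inner ℝ (F.toLocal p q) (F.toLocal p q') = (F.unit⁻¹) ^ 2 * inner ℝ (q - p) (q' - p) := by
  rw [toLocal, toLocal, real_inner_smul_left, real_inner_smul_right, F.axes.inner_map_map]
  ring

end Frame

/-- The points at which a family of points takes several of its values, that is, the positions
holding more than one robot. -/
def multiplePoints {ι α : Type*} (p : ι → α) : Set α := {x | (p ⁻¹' {x}).Nontrivial}

theorem multiplePoints_eq_empty {ι α : Type*} {p : ι → α} :
    multiplePoints p = ∅ ↔ Function.Injective p := by
  simp only [Set.eq_empty_iff_forall_notMem, multiplePoints, Set.mem_ofPred_eq,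
    Set.not_nontrivial_iff]
  exact ⟨fun h i j hij => h _ hij rfl, fun h x i hi j hj => h (hi.trans hj.symm)⟩

section View

variable {n : ℕ} (F : Frame) (p : Config n) (i : Fin n)

theorem mem_occupied {x : Plane} :
    x ∈ (view F p i).occupied ↔ ∃ j, F.toLocal (p i) (p j) = x := by
  simp [view]

theorem sum_occupied (hp : Function.Injective p) (f : Plane → ℝ) :
    ∑ x ∈ (view F p i).occupied, f x = ∑ j, f (F.toLocal (p i) (p j)) := by
  rw [view, Finset.sum_image]
  exact fun a _ b _ h => hp (F.toLocal_injective _ h)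

theorem coe_multiple : ((view F p i).multiple : Set Plane) =
    F.toLocal (p i) '' multiplePoints p := by
  ext x
  obtain ⟨y, rfl⟩ := F.toLocal_surjective (p i) x
  simp only [view, Finset.coe_filter, Finset.mem_image, Finset.mem_univ, true_and,
    Set.mem_ofPred_eq, (F.toLocal_injective (p i)).eq_iff, Finset.one_lt_card,
    Finset.mem_filter, (F.toLocal_injective (p i)).mem_set_image, multiplePoints,
    Set.Nontrivial, Set.mem_preimage, Set.mem_singleton_iff, ne_eq]
  exact ⟨fun h => h.2, fun h => ⟨⟨h.choose, h.choose_spec.1⟩, h⟩⟩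

theorem multiple_eq_empty : (view F p i).multiple = ∅ ↔ multiplePoints p = ∅ := by
  rw [← Finset.coe_eq_empty, coe_multiple, Set.image_eq_empty]

theorem multiple_eq_singleton {w : Plane} :
    (view F p i).multiple = {F.toLocal (p i) w} ↔ multiplePoints p = {w} := by
  rw [← Finset.coe_inj, coe_multiple, Finset.coe_singleton, ← Set.image_singleton,
    (F.toLocal_injective _).image_injective.eq_iff]

theorem two_le_card_multiple :
    2 ≤ (view F p i).multiple.card ↔ (multiplePoints p).Nontrivial := by
  rw [← Nat.lt_iff_add_one_le, Finset.one_lt_card_iff_nontrivial, Finset.Nontrivial, coe_multiple,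
    Set.image_nontrivial (F.toLocal_injective _)]

end View

/-! ### Moves of bounded length -/

section Moves

variable {s : ℝ} {p q : Plane}

theorem moveToward_self (hs : 0 ≤ s) (p : Plane) : moveToward s p p = p := by
  simp [moveToward, hs]

theorem exists_moveToward_eq_lineMap (hs : 0 < s) (p q : Plane) :
    ∃ a : ℝ, 0 < a ∧ a ≤ 1 ∧ moveToward s p q = AffineMap.lineMap p q a := by
  unfold moveToward
  split_ifs with h
  · exact ⟨1, one_pos, le_rfl, by simp⟩
  · have hd : 0 < dist p q := hs.trans (not_le.1 h)
    refine ⟨s / dist p q, by positivity, (div_le_one hd).2 (not_le.1 h).le, ?_⟩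
    rw [AffineMap.lineMap_apply, vsub_eq_sub, vadd_eq_add, add_comm]

theorem wbtw_moveToward (hs : 0 < s) (p q : Plane) : Wbtw ℝ p (moveToward s p q) q := by
  obtain ⟨a, h0, h1, h⟩ := exists_moveToward_eq_lineMap hs p q
  exact ⟨a, ⟨h0.le, h1⟩, h.symm⟩

theorem moveToward_eq_left_iff (hs : 0 < s) : moveToward s p q = p ↔ p = q := by
  refine ⟨fun h => ?_, fun h => h ▸ moveToward_self hs.le p⟩
  obtain ⟨a, h0, -, ha⟩ := exists_moveToward_eq_lineMap hs p q
  exact (AffineMap.lineMap_eq_left_iff.1 (ha.symm.trans h)).resolve_right h0.ne'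

theorem dist_moveToward (hs : 0 < s) (p q : Plane) :
    dist (moveToward s p q) q = max (dist p q - s) 0 := by
  unfold moveToward
  split_ifs with h
  · rw [dist_self, max_eq_right (by linarith)]
  · have hd : 0 < dist p q := hs.trans (not_le.1 h)
    have e : p + (s / dist p q) • (q - p) - q = (1 - s / dist p q) • (p - q) := by module
    rw [dist_eq_norm, e, norm_smul, ← dist_eq_norm p q, max_eq_left (by linarith),
      Real.norm_of_nonneg (by rw [sub_nonneg, div_le_one hd]; exact (not_le.1 h).le)]
    field_simp

theorem dist_moveToward_lt (hs : 0 < s) (h : p ≠ q) : dist (moveToward s p q) q < dist p q := by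
  rw [dist_moveToward hs]
  exact max_lt (by linarith) (dist_pos.2 h)

theorem ceil_max_sub_div_lt {d : ℝ} (hs : 0 < s) (hd : 0 < d) :
    ⌈max (d - s) 0 / s⌉₊ < ⌈d / s⌉₊ := by
  have hpos : 0 < d / s := div_pos hd hs
  rcases le_total d s with h | h
  · rw [max_eq_right (sub_nonpos.2 h), zero_div, Nat.ceil_zero]
    exact Nat.ceil_pos.2 hpos
  · rw [max_eq_left (sub_nonneg.2 h), sub_div, div_self hs.ne', Nat.ceil_sub_one]
    exact Nat.sub_lt (Nat.ceil_pos.2 hpos) one_pos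

end Moves

/-! ### Medians -/

section Median

variable {ι E : Type*} [Fintype ι]

/-- A geometric median (Fermat-Weber point) of a finite family of points: it minimizes the sum of
the distances to them. -/
def IsMedian [Dist E] (p : ι → E) (w : E) : Prop := ∀ y, ∑ i, dist (p i) w ≤ ∑ i, dist (p i) y

/-- A point that is the only geometric median of a finite family of points. -/
def IsStrictMedian [Dist E] (p : ι → E) (w : E) : Prop :=
  ∀ y, y ≠ w → ∑ i, dist (p i) w < ∑ i, dist (p i) y

theorem exists_isMedian [PseudoMetricSpace E] [ProperSpace E] [Nonempty ι] (p : ι → E) :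
    ∃ w, IsMedian p w := by
  have hc : Continuous fun y => ∑ i, dist (p i) y := by fun_prop
  obtain ⟨i₀⟩ := ‹Nonempty ι›
  have : Nonempty E := ⟨p i₀⟩
  refine hc.exists_forall_le (tendsto_atTop_mono (fun y => ?_)
    (tendsto_dist_left_cocompact_atTop (p i₀)))
  exact Finset.single_le_sum (f := fun i => dist (p i) y) (fun _ _ => dist_nonneg)
    (Finset.mem_univ i₀)

theorem exists_isMedian_ne [PseudoMetricSpace E] [ProperSpace E] [Nonempty ι] {p : ι → E}
    (h : ∀ w, ¬ IsStrictMedian p w) : ∃ u v, u ≠ v ∧ IsMedian p u ∧ IsMedian p v := by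
  obtain ⟨u, hu⟩ := exists_isMedian p
  have hnot := h u
  simp only [IsStrictMedian, not_forall, not_lt] at hnot
  obtain ⟨v, hne, hv⟩ := hnot
  exact ⟨u, v, Ne.symm hne, hu, fun y => hv.trans (hu y)⟩

section StrictConvex

variable [NormedAddCommGroup E] [NormedSpace ℝ E] [StrictConvexSpace ℝ E] {p : ι → E} {u v : E}

-- The midpoint of two medians is not better than them, so all triangle inequalities are equalities.
theorem IsMedian.sameRay (hu : IsMedian p u) (hv : IsMedian p v) (i : ι) :
    SameRay ℝ (u - p i) (v - p i) := by
  have hmid : ∀ i, 2 * dist (p i) (midpoint ℝ u v) = ‖(u - p i) + (v - p i)‖ := fun i => by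
    have h2 : (u - p i) + (v - p i) = (2 : ℝ) • (midpoint ℝ u v - p i) := by
      rw [midpoint_eq_smul_add, smul_sub, smul_smul, mul_invOf_self, one_smul]
      module
    rw [h2, norm_smul, Real.norm_ofNat, dist_comm, dist_eq_norm]
  have hle : ∀ i ∈ Finset.univ, 2 * dist (p i) (midpoint ℝ u v) ≤ dist (p i) u + dist (p i) v :=
    fun i _ => by
      rw [hmid, dist_comm (p i) u, dist_comm (p i) v, dist_eq_norm, dist_eq_norm]
      exact norm_add_le _ _
  have hsum : ∑ i, 2 * dist (p i) (midpoint ℝ u v) = ∑ i, (dist (p i) u + dist (p i) v) := by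
    refine le_antisymm (Finset.sum_le_sum hle) ?_
    rw [Finset.sum_add_distrib, ← Finset.mul_sum]
    linarith [hu (midpoint ℝ u v), hv (midpoint ℝ u v)]
  rw [sameRay_iff_norm_add, ← hmid, (Finset.sum_eq_sum_iff_of_le hle).1 hsum i (Finset.mem_univ i),
    dist_comm (p i) u, dist_comm (p i) v, dist_eq_norm, dist_eq_norm]

theorem IsMedian.exists_lineMap_eq (hu : IsMedian p u) (hv : IsMedian p v) (hne : u ≠ v) :
    ∃ s : ι → ℝ, ∀ i, p i = AffineMap.lineMap u v (s i) ∧ (s i ≤ 0 ∨ 1 ≤ s i) := by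
  suffices h : ∀ i, ∃ a : ℝ, p i = AffineMap.lineMap u v a ∧ (a ≤ 0 ∨ 1 ≤ a) from
    ⟨fun i => (h i).choose, fun i => (h i).choose_spec⟩
  intro i
  rcases wbtw_total_of_sameRay_vsub_left (x := p i) (y := u) (z := v) (hu.sameRay hv i) with h | h
  · obtain ⟨a, ha, hai⟩ :=
      (wbtw_iff_right_eq_or_left_mem_image_Ici.1 h).resolve_left hne.symm
    exact ⟨1 - a, by rw [AffineMap.lineMap_apply_one_sub, hai], Or.inl (sub_nonpos.2 ha)⟩
  · obtain ⟨a, ha, hai⟩ := (wbtw_iff_right_eq_or_left_mem_image_Ici.1 h).resolve_left hne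
    exact ⟨a, hai.symm, Or.inr ha⟩

theorem collinear_range_of_forall_not_isStrictMedian [ProperSpace E] [Nonempty ι]
    (h : ∀ w, ¬ IsStrictMedian p w) : Collinear ℝ (Set.range p) := by
  obtain ⟨u, v, hne, hu, hv⟩ := exists_isMedian_ne h
  obtain ⟨s, hs⟩ := hu.exists_lineMap_eq hv hne
  refine (collinear_iff_exists_forall_eq_smul_vadd _).2 ⟨u, v - u, ?_⟩
  rintro _ ⟨i, rfl⟩
  exact ⟨s i, by rw [(hs i).1, AffineMap.lineMap_apply, vsub_eq_sub]⟩

end StrictConvex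

-- Passing from `u` to `v` changes the distance to each point by `dist u v`, up to sign, and these
-- changes add up to zero.
theorem IsMedian.card_filter_eq [NormedAddCommGroup E] [NormedSpace ℝ E] {p : ι → E} {u v : E}
    (hu : IsMedian p u) (hv : IsMedian p v) (hne : u ≠ v) {s : ι → ℝ}
    (hs : ∀ i, p i = AffineMap.lineMap u v (s i) ∧ (s i ≤ 0 ∨ 1 ≤ s i)) :
    (Finset.univ.filter fun i => s i ≤ 0).card = (Finset.univ.filter fun i => ¬ s i ≤ 0).card := by
  have hterm : ∀ i, dist (p i) v - dist (p i) u = (if s i ≤ 0 then 1 else -1) * dist u v := by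
    intro i
    rw [(hs i).1, dist_lineMap_left, dist_lineMap_right, Real.norm_eq_abs, Real.norm_eq_abs,
      ← sub_mul]
    congr 1
    split_ifs with h0
    · rw [abs_of_nonpos h0, abs_of_nonneg (by linarith)]
      ring
    · have h1 := (hs i).2.resolve_left h0
      rw [abs_of_nonpos (by linarith), abs_of_nonneg (by linarith)]
      ring
  have hsum : ∑ i, (dist (p i) v - dist (p i) u) = 0 := by
    rw [Finset.sum_sub_distrib, le_antisymm (hv u) (hu v), sub_self]
  simp only [hterm, ← Finset.sum_mul] at hsum
  have hzero := (mul_eq_zero.1 hsum).resolve_right (dist_ne_zero.2 hne)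
  rwa [Finset.sum_ite, Finset.sum_const, Finset.sum_const, nsmul_eq_mul, nsmul_eq_mul, mul_one,
    mul_neg_one, ← sub_eq_add_neg, sub_eq_zero, Nat.cast_inj] at hzero

theorem exists_lt_of_one_lt_card {κ α : Type*} [LinearOrder α] {s : κ → α}
    (hs : Function.Injective s) {L : Finset κ} (h : 1 < L.card) :
    ∃ a ∈ L, ∃ b ∈ L, s a < s b := by
  obtain ⟨a, ha, b, hb, hab⟩ := Finset.one_lt_card.1 h
  rcases lt_or_gt_of_ne (hs.ne hab) with h | h
  · exact ⟨a, ha, b, hb, h⟩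
  · exact ⟨b, hb, a, ha, h⟩

/-- The point with index `i` is strictly between two others of the family. -/
def IsInner [NormedAddCommGroup E] [NormedSpace ℝ E] {κ : Type*} (p : κ → E) (i : κ) : Prop :=
  ∃ j k, Sbtw ℝ (p j) (p i) (p k)

-- Two medians have equally many points on either side, hence at least two, so that there are at
-- least four points on their line.
theorem exists_isInner_ne [NormedAddCommGroup E] [NormedSpace ℝ E] [StrictConvexSpace ℝ E]
    [ProperSpace E] {p : ι → E} (hp : Function.Injective p) (hcard : 3 ≤ Fintype.card ι)
    (h : ∀ w, ¬ IsStrictMedian p w) : ∃ j k, j ≠ k ∧ IsInner p j ∧ IsInner p k := by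
  have : Nonempty ι := Fintype.card_pos_iff.1 (by omega)
  obtain ⟨u, v, hne, hu, hv⟩ := exists_isMedian_ne h
  obtain ⟨s, hs⟩ := hu.exists_lineMap_eq hv hne
  have hinj : Function.Injective s := fun i j hij => hp (by rw [(hs i).1, (hs j).1, hij])
  have hsbtw : ∀ {i j k}, s i < s j → s j < s k → Sbtw ℝ (p i) (p j) (p k) := fun hij hjk => by
    rw [(hs _).1, (hs _).1, (hs _).1, (AffineMap.lineMap_injective ℝ hne).sbtw_map_iff]
    exact .of_lt_of_lt hij hjk
  have hhalf := hu.card_filter_eq hv hne hs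
  have htotal := Finset.card_filter_add_card_filter_not (s := Finset.univ) fun i => s i ≤ 0
  rw [Finset.card_univ] at htotal
  obtain ⟨i, -, j, hj, hij⟩ := exists_lt_of_one_lt_card hinj
    (L := Finset.univ.filter fun i => s i ≤ 0) (by omega)
  obtain ⟨k, hk, l, -, hkl⟩ := exists_lt_of_one_lt_card hinj
    (L := Finset.univ.filter fun i => ¬ s i ≤ 0) (by omega)
  simp only [Finset.mem_filter, Finset.mem_univ, true_and, not_le] at hj hk
  have hjk := hj.trans_lt hk
  exact ⟨j, k, fun e => hjk.ne (e ▸ rfl), ⟨i, k, hsbtw hij hjk⟩, ⟨j, l, hsbtw hjk hkl⟩⟩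

end Median

/-! ### Ends of a line, and orthogonal displacements -/

section Extreme

variable {ι V : Type*} [NormedAddCommGroup V] [InnerProductSpace ℝ V] {p q : ι → V}

/-- Seen from the point with index `i`, no two points of the family are at an obtuse angle. On a
line, this characterizes its two ends by inner products only, which a robot can compute. -/
def IsExtreme (p : ι → V) (i : ι) : Prop := ∀ j k, (0 : ℝ) ≤ inner ℝ (p j - p i) (p k - p i)

theorem IsInner.not_isExtreme {i : ι} (hi : IsInner p i) : ¬ IsExtreme p i := by
  obtain ⟨j, k, h⟩ := hi
  intro he
  have hneg := InnerProductGeometry.inner_eq_neg_mul_norm_of_angle_eq_pi h.angle₁₂₃_eq_pi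
  have hpos : 0 < ‖p j -ᵥ p i‖ * ‖p k -ᵥ p i‖ :=
    mul_pos (norm_pos_iff.2 (vsub_ne_zero.2 h.left_ne))
      (norm_pos_iff.2 (vsub_ne_zero.2 h.ne_right.symm))
  have hjk := he j k
  rw [← vsub_eq_sub, ← vsub_eq_sub, hneg] at hjk
  linarith

theorem exists_isExtreme [Finite ι] [Nonempty ι] (h : Collinear ℝ (Set.range p)) :
    ∃ i, IsExtreme p i := by
  obtain ⟨b, d, hbd⟩ := (collinear_iff_exists_forall_eq_smul_vadd _).1 h
  choose s hs using fun i => hbd (p i) ⟨i, rfl⟩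
  obtain ⟨i, hi⟩ := Finite.exists_min s
  refine ⟨i, fun j k => ?_⟩
  have hsub : ∀ j, p j - p i = (s j - s i) • d := fun j => by
    rw [hs j, hs i, vadd_eq_add, vadd_eq_add]
    module
  rw [hsub, hsub, real_inner_smul_left, real_inner_smul_right]
  exact mul_nonneg (sub_nonneg.2 (hi j)) (mul_nonneg (sub_nonneg.2 (hi k)) real_inner_self_nonneg)

theorem exists_ne_zero_forall_inner_sub_eq_zero [FiniteDimensional ℝ V] {s : Set V}
    (h : Collinear ℝ s) (hV : 1 < Module.finrank ℝ V) :
    ∃ e : V, e ≠ 0 ∧ ∀ x ∈ s, ∀ y ∈ s, inner ℝ e (x - y) = (0 : ℝ) := by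
  have hne : (vectorSpan ℝ s)ᗮ ≠ ⊥ := fun hbot => by
    have hle := h.finrank_le_one
    rw [Submodule.orthogonal_eq_bot_iff.1 hbot, finrank_top] at hle
    omega
  obtain ⟨e, he, he0⟩ := Submodule.exists_mem_ne_zero_of_ne_bot hne
  exact ⟨e, he0, fun x hx y hy =>
    Submodule.inner_left_of_mem_orthogonal (vsub_mem_vectorSpan ℝ hx hy) he⟩

theorem eq_of_eq_of_inner_displacement_eq_zero
    (h : ∀ i j, inner ℝ (q i - p i) (p j - p i) = (0 : ℝ)) {i j : ι} (hij : q i = q j) :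
    p i = p j := by
  have hji : p j - p i = (q i - p i) - (q j - p j) := by rw [hij]; abel
  have hj : inner ℝ (q j - p j) (p j - p i) = (0 : ℝ) := by
    rw [← neg_sub (p i), inner_neg_right, h j i, neg_zero]
  refine (sub_eq_zero.1 (inner_self_eq_zero (𝕜 := ℝ).1 ?_)).symm
  nth_rw 1 [hji]
  rw [inner_sub_left, h i j, hj, sub_zero]

theorem eq_of_collinear_of_inner_displacement_eq_zero
    (h : ∀ i j, inner ℝ (q i - p i) (p j - p i) = (0 : ℝ)) (hp : Collinear ℝ (Set.range p))
    (hq : Collinear ℝ (Set.range q)) {a b : ι} (ha : q a = p a) (hb : q b = p b)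
    (hab : p a ≠ p b) : q = p := by
  funext i
  have hpi : p i ∈ affineSpan ℝ {p a, p b} := hp.mem_affineSpan_of_mem_of_ne ⟨a, rfl⟩ ⟨b, rfl⟩
    ⟨i, rfl⟩ hab
  have hqi : q i ∈ affineSpan ℝ {p a, p b} := hq.mem_affineSpan_of_mem_of_ne ⟨a, ha⟩ ⟨b, hb⟩
    ⟨i, rfl⟩ hab
  have hdir := AffineSubspace.vsub_mem_direction hqi hpi
  rw [direction_affineSpan, mem_vectorSpan_pair] at hdir
  obtain ⟨r, hr⟩ := hdir
  have hperp : inner ℝ (q i - p i) (p a - p b) = (0 : ℝ) := by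
    rw [← sub_sub_sub_cancel_right (p a) _ (p i), inner_sub_right, h, h, sub_zero]
  refine sub_eq_zero.1 (inner_self_eq_zero (𝕜 := ℝ).1 ?_)
  nth_rw 2 [← vsub_eq_sub]
  rw [← hr, vsub_eq_sub, real_inner_smul_right, hperp, mul_zero]

end Extreme

/-! ### The deterministic algorithm -/

/-- The common destination that a view determines: the multiple position if there is exactly one,
and the strict median of the positions if all of them are simple. -/
def IsTarget (v : View) (w : Plane) : Prop :=
  v.multiple = {w} ∨ v.multiple = ∅ ∧
    ∀ y, y ≠ w → ∑ x ∈ v.occupied, dist x w < ∑ x ∈ v.occupied, dist x y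

open Classical in
/-- The destination of a robot that knows the target `w`: only the robots closest to the target,
among those not yet there, move to it. -/
def approach (v : View) (w : Plane) : Plane :=
  if ∀ x ∈ v.occupied, x ≠ w → dist 0 w ≤ dist x w then w else 0

open Classical in
/-- The destination of a robot that sees no target, so that all robots are on a line: the robots at
its ends leave the line perpendicularly. -/
def sidestep (v : View) : Plane :=
  if h : (∀ x ∈ v.occupied, ∀ y ∈ v.occupied, (0 : ℝ) ≤ inner ℝ x y) ∧
      ∃ u : Plane, u ≠ 0 ∧ ∀ x ∈ v.occupied, inner ℝ u x = (0 : ℝ)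
  then h.2.choose else 0

open Classical in
/-- The deterministic algorithm `A_GP`: approach the target if there is one, leave the common line
otherwise. -/
def gatherAlg : DetAlgorithm := fun v =>
  if h : ∃ w, IsTarget v w then approach v h.choose else sidestep v

theorem IsTarget.unique {v : View} {w w' : Plane} (h : IsTarget v w) (h' : IsTarget v w') :
    w = w' := by
  rcases h with h | ⟨h, hm⟩ <;> rcases h' with h' | ⟨h', hm'⟩
  · exact Finset.singleton_injective (h.symm.trans h')
  · simp [h] at h'
  · simp [h] at h'
  · by_contra hne
    exact lt_asymm (hm w' (Ne.symm hne)) (hm' w hne)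

theorem IsTarget.gatherAlg_eq {v : View} {w : Plane} (h : IsTarget v w) :
    gatherAlg v = approach v w := by
  have hex : ∃ w, IsTarget v w := ⟨w, h⟩
  rw [gatherAlg, dif_pos hex, hex.choose_spec.unique h]

section Approach

variable {n : ℕ} {p : Config n} {w : Plane}

/-- The target of the robots in global coordinates, see `isTarget_view_iff`. -/
def IsPole (p : Config n) (w : Plane) : Prop :=
  multiplePoints p = {w} ∨ multiplePoints p = ∅ ∧ IsStrictMedian p w

theorem IsPole.not_nontrivial (h : IsPole p w) : ¬ (multiplePoints p).Nontrivial := by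
  rcases h with h | ⟨h, -⟩ <;> simp [h]

theorem GatheredAt.isPole (hn : 2 ≤ n) (h : GatheredAt p w) : IsPole p w := by
  have : Nontrivial (Fin n) := Fin.nontrivial_iff_two_le.2 hn
  refine Or.inl (Set.eq_singleton_iff_unique_mem.2 ⟨?_, ?_⟩)
  · exact (Set.nontrivial_univ (α := Fin n)).mono fun i _ => h i
  · rintro y ⟨i, rfl, -⟩
    exact h i

theorem exists_isPole_or_injective (h : ¬ (multiplePoints p).Nontrivial) :
    (∃ w, IsPole p w) ∨ Function.Injective p ∧ ∀ w, ¬ IsStrictMedian p w := by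
  rcases (Set.not_nontrivial_iff.1 h).eq_empty_or_singleton with h | ⟨w, h⟩
  · by_cases hm : ∃ w, IsStrictMedian p w
    · exact Or.inl (hm.imp fun w hw => Or.inr ⟨h, hw⟩)
    · exact Or.inr ⟨multiplePoints_eq_empty.1 h, not_exists.1 hm⟩
  · exact Or.inl ⟨w, Or.inl h⟩

theorem isTarget_view_iff (F : Frame) (p : Config n) (i : Fin n) (w : Plane) :
    IsTarget (view F p i) (F.toLocal (p i) w) ↔ IsPole p w := by
  rw [IsTarget, IsPole, multiple_eq_singleton, multiple_eq_empty]
  refine or_congr_right (and_congr_right fun hp => ?_)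
  rw [multiplePoints_eq_empty] at hp
  refine (F.toLocal_surjective (p i)).forall.trans (forall_congr' fun y => ?_)
  simp only [(F.toLocal_injective (p i)).ne_iff, sum_occupied F p i hp, F.dist_toLocal,
    ← Finset.mul_sum, mul_lt_mul_iff_right₀ (inv_pos.2 F.unit_pos)]

/-! ### Approaching the target -/

/-- The robot `i` is closest to `w` among the robots that are not at `w`. -/
def IsClosest (p : Config n) (w : Plane) (i : Fin n) : Prop :=
  ∀ j, p j ≠ w → dist (p i) w ≤ dist (p j) w

theorem exists_isClosest (h : ¬ GatheredAt p w) : ∃ i, p i ≠ w ∧ IsClosest p w i := by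
  classical
  obtain ⟨k, hk⟩ := not_forall.1 h
  obtain ⟨i, hi, hmin⟩ := (Finset.univ.filter fun j => p j ≠ w).exists_min_image
    (fun j => dist (p j) w) ⟨k, by simp [hk]⟩
  exact ⟨i, by simpa using hi, fun j hj => hmin j (by simp [hj])⟩

open Classical in
theorem IsPole.toGlobal_gatherAlg (h : IsPole p w) (F : Frame) (i : Fin n) :
    F.toGlobal (p i) (gatherAlg (view F p i)) = if IsClosest p w i then w else p i := by
  rw [((isTarget_view_iff F p i w).2 h).gatherAlg_eq, approach]
  have hiff : (∀ x ∈ (view F p i).occupied, x ≠ F.toLocal (p i) w →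
      dist 0 (F.toLocal (p i) w) ≤ dist x (F.toLocal (p i) w)) ↔ IsClosest p w i := by
    simp only [mem_occupied, forall_exists_index, forall_apply_eq_imp_iff, IsClosest,
      (F.toLocal_injective (p i)).ne_iff]
    rw [← F.toLocal_self (p i)]
    simp only [F.dist_toLocal, mul_le_mul_iff_right₀ (inv_pos.2 F.unit_pos)]
  simp only [hiff, apply_ite (F.toGlobal (p i)), F.toGlobal_toLocal, F.toGlobal_zero]

open Classical in
/-- A step in which the active robots that are closest to `w` move toward it. -/
def approachStep (σ : Fin n → ℝ) (act : Finset (Fin n)) (w : Plane) (p : Config n) : Config n :=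
  fun i => if i ∈ act ∧ IsClosest p w i then moveToward (σ i) (p i) w else p i

section ApproachStep

variable {σ : Fin n → ℝ} {act : Finset (Fin n)}

theorem IsPole.step_gatherAlg (h : IsPole p w) (hσ : ∀ i, 0 < σ i) (F : Fin n → Frame)
    (coin : Fin n → Fin 2) :
    step gatherAlg.toProtocol F σ act coin p = approachStep σ act w p := by
  funext i
  simp only [step, DetAlgorithm.toProtocol, h.toGlobal_gatherAlg, approachStep]
  by_cases hi : i ∈ act <;> by_cases hc : IsClosest p w i <;>
    simp [hi, hc, moveToward_self (hσ i).le]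

theorem approachStep_eq_or (i : Fin n) : approachStep σ act w p i = p i ∨
    IsClosest p w i ∧ approachStep σ act w p i = moveToward (σ i) (p i) w := by
  unfold approachStep
  split_ifs with hi
  · exact Or.inr ⟨hi.2, rfl⟩
  · exact Or.inl rfl

theorem approachStep_ne (hσ : ∀ i, 0 < σ i) {i : Fin n} (hi : i ∈ act) (hc : IsClosest p w i)
    (hw : p i ≠ w) : approachStep σ act w p i ≠ p i := by
  rwa [approachStep, if_pos ⟨hi, hc⟩, Ne, moveToward_eq_left_iff (hσ i)]

theorem wbtw_approachStep (hσ : ∀ i, 0 < σ i) (i : Fin n) :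
    Wbtw ℝ (p i) (approachStep σ act w p i) w := by
  rcases approachStep_eq_or (p := p) (w := w) (σ := σ) (act := act) i with h | ⟨-, h⟩ <;> rw [h]
  · exact wbtw_self_left ℝ _ _
  · exact wbtw_moveToward (hσ i) _ _

theorem approachStep_eq_of_eq (hσ : ∀ i, 0 < σ i) {i : Fin n} (hi : p i = w) :
    approachStep σ act w p i = w := by
  have h := wbtw_approachStep (w := w) (p := p) (act := act) hσ i
  rwa [hi, wbtw_self_iff] at h

theorem dist_approachStep_le (hσ : ∀ i, 0 < σ i) (i : Fin n) :
    dist (approachStep σ act w p i) w ≤ dist (p i) w := by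
  rw [← (wbtw_approachStep (w := w) (p := p) (act := act) hσ i).dist_add_dist]
  exact le_add_of_nonneg_left dist_nonneg

theorem eq_of_wbtw_of_dist_eq {E : Type*} [NormedAddCommGroup E] [NormedSpace ℝ E]
    {x y z w : E} (hx : Wbtw ℝ x z w) (hy : Wbtw ℝ y z w) (hz : z ≠ w)
    (hd : dist x w = dist y w) : x = y := by
  have hray : SameRay ℝ (w - x) (w - y) := hx.sameRay_vsub_right.trans hy.sameRay_vsub_right.symm
    fun h0 => absurd (sub_eq_zero.1 h0) hz.symm
  rw [dist_eq_norm', dist_eq_norm'] at hd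
  exact sub_right_injective (hray.eq_of_norm_eq hd)

-- A robot joining another one that does not move would have been further away from `w`, and two
-- moving robots are at the same distance from `w`.
theorem eq_of_approachStep_eq (hσ : ∀ i, 0 < σ i) {i j : Fin n}
    (hij : approachStep σ act w p i = approachStep σ act w p j)
    (hw : approachStep σ act w p i ≠ w) : p i = p j := by
  have hi : p i ≠ w := fun e => hw (approachStep_eq_of_eq hσ e)
  have hj : p j ≠ w := fun e => hw (hij.trans (approachStep_eq_of_eq hσ e))
  rcases approachStep_eq_or (p := p) (w := w) (σ := σ) (act := act) i with ei | ⟨ci, ei⟩ <;>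
    rcases approachStep_eq_or (p := p) (w := w) (σ := σ) (act := act) j with ej | ⟨cj, ej⟩
  · rw [← ei, ← ej, hij]
  · have hlt := dist_moveToward_lt (hσ j) hj
    rw [← ej, ← hij, ei] at hlt
    exact absurd (cj i hi) hlt.not_ge
  · have hlt := dist_moveToward_lt (hσ i) hi
    rw [← ei, hij, ej] at hlt
    exact absurd (ci j hj) hlt.not_ge
  · exact eq_of_wbtw_of_dist_eq (wbtw_approachStep hσ i) (hij ▸ wbtw_approachStep hσ j) hw
      (le_antisymm (ci j hj) (cj i hi))

theorem IsStrictMedian.approachStep (h : IsStrictMedian p w) (hσ : ∀ i, 0 < σ i) :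
    IsStrictMedian (approachStep σ act w p) w := by
  intro y hy
  set q := Robots.approachStep σ act w p
  have hw : ∑ i, dist (p i) w = ∑ i, dist (p i) (q i) + ∑ i, dist (q i) w := by
    rw [← Finset.sum_add_distrib]
    exact Finset.sum_congr rfl fun i _ => (wbtw_approachStep hσ i).dist_add_dist.symm
  have hy' : ∑ i, dist (p i) y ≤ ∑ i, dist (p i) (q i) + ∑ i, dist (q i) y := by
    rw [← Finset.sum_add_distrib]
    exact Finset.sum_le_sum fun i _ => dist_triangle _ _ _
  linarith [h y hy]

theorem IsPole.approachStep (h : IsPole p w) (hσ : ∀ i, 0 < σ i) :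
    IsPole (approachStep σ act w p) w := by
  have hp : multiplePoints p ⊆ {w} := by rcases h with h | ⟨h, -⟩ <;> simp [h]
  have hq : multiplePoints (Robots.approachStep σ act w p) ⊆ {w} := by
    rintro x ⟨i, rfl, j, hji, hne⟩
    by_contra hw
    exact hw (approachStep_eq_of_eq hσ
      (hp ⟨i, rfl, j, (eq_of_approachStep_eq hσ hji.symm hw).symm, hne⟩))
  rcases h with h | ⟨-, h⟩
  · obtain ⟨i, hi, j, hj, hne⟩ : w ∈ multiplePoints p := h ▸ Set.mem_singleton w
    exact Or.inl (hq.antisymm (Set.singleton_subset_iff.2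
      ⟨i, approachStep_eq_of_eq hσ hi, j, approachStep_eq_of_eq hσ hj, hne⟩))
  · exact (Set.subset_singleton_iff_eq.1 hq).symm.imp id fun hq => ⟨hq, h.approachStep hσ⟩

/-- The total number of moves that the robots need to reach `w`. -/
def workload (σ : Fin n → ℝ) (w : Plane) (p : Config n) : ℕ := ∑ i, ⌈dist (p i) w / σ i⌉₊

theorem workload_approachStep_le (hσ : ∀ i, 0 < σ i) :
    workload σ w (approachStep σ act w p) ≤ workload σ w p :=
  Finset.sum_le_sum fun i _ =>
    Nat.ceil_mono (div_le_div_of_nonneg_right (dist_approachStep_le hσ i) (hσ i).le)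

theorem workload_approachStep_lt (hσ : ∀ i, 0 < σ i) (hne : approachStep σ act w p ≠ p) :
    workload σ w (approachStep σ act w p) < workload σ w p := by
  obtain ⟨i, hi⟩ := Function.ne_iff.1 hne
  refine Finset.sum_lt_sum (fun j _ =>
    Nat.ceil_mono (div_le_div_of_nonneg_right (dist_approachStep_le hσ j) (hσ j).le))
    ⟨i, Finset.mem_univ i, ?_⟩
  have hw : p i ≠ w := fun e => hi ((approachStep_eq_of_eq hσ e).trans e.symm)
  obtain ⟨-, ei⟩ := (approachStep_eq_or i).resolve_left hi
  rw [ei, dist_moveToward (hσ i)]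
  exact ceil_max_sub_div_lt (hσ i) (dist_pos.2 hw)

end ApproachStep

section Run

variable {σ : Fin n → ℝ} {act : ℕ → Finset (Fin n)} {q : ℕ → Config n}

theorem eventually_gatheredAt_of_eventually_approachStep (hσ : ∀ i, 0 < σ i) (hfair : IsFair act)
    (h : ∀ᶠ t in atTop, q (t + 1) = approachStep σ (act t) w (q t)) :
    ∀ᶠ t in atTop, GatheredAt (q t) w := by
  have hle : ∀ᶠ t in atTop, workload σ w (q (t + 1)) ≤ workload σ w (q t) :=
    h.mono fun t ht => ht ▸ workload_approachStep_le hσ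
  have hstill : ∀ᶠ t in atTop, q (t + 1) = q t := by
    filter_upwards [h,
      eventually_succ_eq_of_eventually_succ_le (Φ := fun t => workload σ w (q t)) hle] with t ht heq
    by_contra hne
    rw [ht] at hne heq
    exact (workload_approachStep_lt hσ hne).ne heq
  obtain ⟨T, hT⟩ := eventuallyConst_atTop.1
    (eventuallyConst_atTop_nat.2 (eventually_atTop.1 hstill))
  suffices hg : GatheredAt (q T) w from eventually_atTop.2 ⟨T, fun t ht => (hT t ht).symm ▸ hg⟩
  by_contra hg
  obtain ⟨i, hw, hc⟩ := exists_isClosest hg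
  obtain ⟨t, hi, ht, htT⟩ := ((hfair.frequently i).and_eventually
    (h.and (eventually_ge_atTop T))).exists
  rw [hT t htT, hT (t + 1) (htT.trans t.le_succ)] at ht
  exact approachStep_ne hσ hi hc hw (congrFun ht i).symm

end Run

end Approach

/-! ### Leaving the line -/

section Sidestep

theorem inner_sidestep {v : View} {x : Plane} (hx : x ∈ v.occupied) :
    inner ℝ (sidestep v) x = (0 : ℝ) := by
  unfold sidestep
  split_ifs with h
  · exact h.2.choose_spec.2 x hx
  · exact inner_zero_left x

theorem sidestep_ne_zero {v : View} (hv : ∀ x ∈ v.occupied, ∀ y ∈ v.occupied, (0 : ℝ) ≤ inner ℝ x y)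
    (hu : ∃ u : Plane, u ≠ 0 ∧ ∀ x ∈ v.occupied, inner ℝ u x = (0 : ℝ)) : sidestep v ≠ 0 := by
  rw [sidestep, dif_pos ⟨hv, hu⟩]
  exact hu.choose_spec.1

variable {n : ℕ} (F : Frame) (p : Config n) (i : Fin n)

theorem isExtreme_view_iff :
    (∀ x ∈ (view F p i).occupied, ∀ y ∈ (view F p i).occupied, (0 : ℝ) ≤ inner ℝ x y) ↔
      IsExtreme p i := by
  have hpos : 0 < F.unit⁻¹ ^ 2 := by have := F.unit_pos; positivity
  simp only [mem_occupied, forall_exists_index, forall_apply_eq_imp_iff, F.inner_toLocal,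
    mul_nonneg_iff_of_pos_left hpos, IsExtreme]

theorem inner_toGlobal_sidestep_sub (j : Fin n) :
    inner ℝ (F.toGlobal (p i) (sidestep (view F p i)) - p i) (p j - p i) = (0 : ℝ) := by
  have h := inner_sidestep ((mem_occupied F p i).2 ⟨j, rfl⟩)
  rw [← F.toLocal_toGlobal (p i) (sidestep _), F.inner_toLocal] at h
  exact (mul_eq_zero.1 h).resolve_left (pow_ne_zero 2 (inv_ne_zero F.unit_pos.ne'))

theorem toGlobal_sidestep_eq_iff (hp : Collinear ℝ (Set.range p)) :
    F.toGlobal (p i) (sidestep (view F p i)) = p i ↔ ¬ IsExtreme p i := by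
  have hzero : F.toGlobal (p i) (sidestep (view F p i)) = p i ↔ sidestep (view F p i) = 0 := by
    rw [← (F.toLocal_injective (p i)).eq_iff, F.toLocal_toGlobal, F.toLocal_self]
  rw [hzero]
  refine ⟨fun h he => ?_, fun h => ?_⟩
  · obtain ⟨e, he0, hperp⟩ := exists_ne_zero_forall_inner_sub_eq_zero hp (by simp)
    refine sidestep_ne_zero ((isExtreme_view_iff F p i).2 he) ⟨F.toLocal (p i) (p i + e), ?_, ?_⟩ h
    · rwa [← F.toLocal_self (p i), (F.toLocal_injective (p i)).ne_iff, Ne, add_eq_left]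
    · simp only [mem_occupied, forall_exists_index, forall_apply_eq_imp_iff, F.inner_toLocal,
        add_sub_cancel_left]
      exact fun j => by rw [hperp _ ⟨j, rfl⟩ _ ⟨i, rfl⟩, mul_zero]
  · rw [sidestep, dif_neg fun hv => h ((isExtreme_view_iff F p i).1 hv.1)]

theorem gatherAlg_eq_sidestep (h : ∀ w, ¬ IsPole p w) :
    gatherAlg (view F p i) = sidestep (view F p i) := by
  have hnot : ¬ ∃ w, IsTarget (view F p i) w := by
    rw [(F.toLocal_surjective (p i)).exists]
    simpa only [isTarget_view_iff, not_exists] using h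
  rw [gatherAlg, dif_neg hnot]

end Sidestep

section Step

variable {n : ℕ} {p : Config n} {F : Fin n → Frame} {σ : Fin n → ℝ}
  {act : Finset (Fin n)} {coin : Fin n → Fin 2}

theorem inner_step_gatherAlg_sub (h : ∀ w, ¬ IsPole p w) (hσ : ∀ i, 0 < σ i) (i j : Fin n) :
    inner ℝ (step gatherAlg.toProtocol F σ act coin p i - p i) (p j - p i) = (0 : ℝ) := by
  simp only [step, DetAlgorithm.toProtocol, gatherAlg_eq_sidestep _ _ _ h]
  split_ifs with hi
  · obtain ⟨a, -, -, ha⟩ := exists_moveToward_eq_lineMap (hσ i) (p i)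
      ((F i).toGlobal (p i) (sidestep (view (F i) p i)))
    rw [ha, ← vsub_eq_sub, AffineMap.lineMap_vsub_left, vsub_eq_sub, real_inner_smul_left,
      inner_toGlobal_sidestep_sub, mul_zero]
  · rw [sub_self, inner_zero_left]

theorem step_gatherAlg_eq_iff (h : ∀ w, ¬ IsPole p w) (hσ : ∀ i, 0 < σ i)
    (hp : Collinear ℝ (Set.range p)) (i : Fin n) :
    step gatherAlg.toProtocol F σ act coin p i = p i ↔ ¬ (i ∈ act ∧ IsExtreme p i) := by
  simp only [step, DetAlgorithm.toProtocol, gatherAlg_eq_sidestep _ _ _ h]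
  split_ifs with hi
  · rw [moveToward_eq_left_iff (hσ i), eq_comm, toGlobal_sidestep_eq_iff _ _ _ hp]
    simp only [hi, true_and]
  · simp only [hi, false_and, not_false_eq_true]

-- The inner robots stay on the old line while an end leaves it, so that the new configuration
-- is not collinear.
theorem exists_isPole_step_gatherAlg (hn : 3 ≤ n) (hp : Function.Injective p)
    (hpole : ∀ w, ¬ IsPole p w) (hσ : ∀ i, 0 < σ i)
    (hne : step gatherAlg.toProtocol F σ act coin p ≠ p) :
    ∃ w, IsPole (step gatherAlg.toProtocol F σ act coin p) w := by
  have : NeZero n := ⟨by omega⟩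
  set q := step gatherAlg.toProtocol F σ act coin p
  have hperp : ∀ i j, inner ℝ (q i - p i) (p j - p i) = (0 : ℝ) :=
    inner_step_gatherAlg_sub hpole hσ
  have hmed : ∀ w, ¬ IsStrictMedian p w := fun w hw =>
    hpole w (Or.inr ⟨multiplePoints_eq_empty.2 hp, hw⟩)
  have hcol := collinear_range_of_forall_not_isStrictMedian hmed
  by_contra! hqpole
  have hqinj : multiplePoints q = ∅ := multiplePoints_eq_empty.2 fun i j hij =>
    hp (eq_of_eq_of_inner_displacement_eq_zero hperp hij)
  have hqcol := collinear_range_of_forall_not_isStrictMedian fun w hw =>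
    hqpole w (Or.inr ⟨hqinj, hw⟩)
  obtain ⟨j, k, hjk, hj, hk⟩ := exists_isInner_ne hp (by simpa using hn) hmed
  have hstay : ∀ i, IsInner p i → q i = p i := fun i hi =>
    (step_gatherAlg_eq_iff hpole hσ hcol i).2 fun he => hi.not_isExtreme he.2
  exact hne (eq_of_collinear_of_inner_displacement_eq_zero hperp hcol hqcol (hstay j hj)
    (hstay k hk) (hp.ne hjk))

end Step

/-! ### Correctness of the deterministic algorithm -/

section Run

variable {n : ℕ} {F : Fin n → Frame} {σ : Fin n → ℝ} {act : ℕ → Finset (Fin n)}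
  {coin : ℕ → Fin n → Fin 2} {q : ℕ → Config n}

theorem exists_isPole_of_run (hn : 3 ≤ n) (hσ : ∀ i, 0 < σ i) (hfair : IsFair act)
    (hq : ∀ t, ¬ (multiplePoints (q t)).Nontrivial →
      q (t + 1) = step gatherAlg.toProtocol F σ (act t) (coin t) (q t))
    {T : ℕ} (hT : ¬ (multiplePoints (q T)).Nontrivial) : ∃ t w, IsPole (q t) w := by
  have : NeZero n := ⟨by omega⟩
  by_contra! hpole
  obtain ⟨hinj, hmed⟩ := (exists_isPole_or_injective hT).resolve_left
    (not_exists.2 (hpole T))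
  have hstill : ∀ t, T ≤ t → q t = q T := fun t ht => by
    induction t, ht using Nat.le_induction with
    | base => rfl
    | succ t _ ih =>
      by_contra hne
      have hstep := hq t (ih ▸ hT)
      rw [ih] at hstep
      obtain ⟨w, hw⟩ := exists_isPole_step_gatherAlg hn hinj (hpole T) hσ (hstep ▸ hne)
      exact hpole (t + 1) w (hstep ▸ hw)
  have hcol := collinear_range_of_forall_not_isStrictMedian hmed
  obtain ⟨i, hi⟩ := exists_isExtreme hcol
  obtain ⟨t, ht, hact⟩ := hfair i T
  have hstep := hq t (hstill t ht ▸ hT)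
  rw [hstill t ht, hstill (t + 1) (ht.trans t.le_succ)] at hstep
  exact (step_gatherAlg_eq_iff (hpole T) hσ hcol i).1 (congrFun hstep i).symm ⟨hact, hi⟩

theorem exists_eventually_gatheredAt_of_run (hn : 3 ≤ n) (hσ : ∀ i, 0 < σ i) (hfair : IsFair act)
    (hq : ∀ t, ¬ (multiplePoints (q t)).Nontrivial →
      q (t + 1) = step gatherAlg.toProtocol F σ (act t) (coin t) (q t))
    (h : ∃ t, ¬ (multiplePoints (q t)).Nontrivial) : ∃ x, ∀ᶠ t in atTop, GatheredAt (q t) x := by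
  obtain ⟨T, hT⟩ := h
  obtain ⟨t₀, w, hw⟩ := exists_isPole_of_run hn hσ hfair hq hT
  have happroach : ∀ t, IsPole (q t) w → q (t + 1) = approachStep σ (act t) w (q t) :=
    fun t ht => (hq t ht.not_nontrivial).trans (ht.step_gatherAlg hσ F _)
  have hpole : ∀ t, t₀ ≤ t → IsPole (q t) w := fun t ht => by
    induction t, ht using Nat.le_induction with
    | base => exact hw
    | succ t _ ih => exact happroach t ih ▸ ih.approachStep hσ
  exact ⟨w, eventually_gatheredAt_of_eventually_approachStep hσ hfair
    (eventually_atTop.2 ⟨t₀, fun t ht => happroach t (hpole t ht)⟩)⟩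

theorem gatherAlg_detGatheringFromDistinct (hn : 3 ≤ n) : DetGatheringFromDistinct n gatherAlg := by
  intro F σ hσ p₀ hp₀ act coin _ hfair
  have hinj : multiplePoints p₀ = ∅ := multiplePoints_eq_empty.2 hp₀
  obtain ⟨x, hx⟩ := exists_eventually_gatheredAt_of_run
    (q := run gatherAlg.toProtocol F σ p₀ act coin) hn hσ hfair (fun _ _ => rfl)
    ⟨0, by simp [run, hinj]⟩
  exact (eventually_atTop.1 hx).imp fun T hT => ⟨x, hT⟩

end Run

/-! ### Random schedules -/

section BorelCantelli

variable {Ω : Type*} {m₀ m : MeasurableSpace Ω} {μ : Measure Ω} [IsFiniteMeasure μ]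

theorem condExp_indicator_one_ae_eq_const (hm : m₀ ≤ m) {C : Set Ω} (hC : MeasurableSet C)
    {r : ENNReal} (h : ∀ E, MeasurableSet[m₀] E → μ (C ∩ E) = r * μ E) :
    μ[C.indicator (1 : Ω → ℝ) | m₀] =ᵐ[μ] fun _ => r.toReal := by
  have hint : Integrable (C.indicator (1 : Ω → ℝ)) μ := (integrable_const 1).indicator hC
  refine (ae_eq_condExp_of_forall_setIntegral_eq hm hint
    (fun E _ _ => (integrable_const _).integrableOn) (fun E hE _ => ?_)
    stronglyMeasurable_const.aestronglyMeasurable).symm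
  rw [setIntegral_const, integral_indicator_one hC, measureReal_restrict_apply hC, measureReal_def,
    measureReal_def, h E hE, ENNReal.toReal_mul, smul_eq_mul, mul_comm]

-- Lévy's conditional Borel-Cantelli lemma, applied to the events `C t ∩ D t`, the conditional
-- probabilities of which are at least `r` on `D t`.
theorem ae_frequently_mem_inter_of_le_condExp {ℱ : Filtration ℕ m} {C D : ℕ → Set Ω} {r : ℝ}
    (hr : 0 < r) (hC : ∀ t, MeasurableSet[ℱ (t + 1)] (C t)) (hD : ∀ t, MeasurableSet[ℱ t] (D t))
    (h : ∀ t, ∀ᵐ ω ∂μ, r ≤ (μ[(C t).indicator (1 : Ω → ℝ) | ℱ t]) ω) :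
    ∀ᵐ ω ∂μ, (∃ᶠ t in atTop, ω ∈ D t) → ∃ᶠ t in atTop, ω ∈ C t ∩ D t := by
  let G : ℕ → Set Ω := fun t => Nat.casesOn t ∅ fun t => C t ∩ D t
  have hG : ∀ t, MeasurableSet[ℱ t] (G t) := fun t => by
    cases t with
    | zero => exact @MeasurableSet.empty _ (ℱ 0)
    | succ t => exact (hC t).inter (ℱ.mono (Nat.le_succ t) _ (hD t))
  have hcond : ∀ t, μ[(G (t + 1)).indicator (1 : Ω → ℝ) | ℱ t] =ᵐ[μ]
      (D t).indicator (μ[(C t).indicator (1 : Ω → ℝ) | ℱ t]) := fun t => by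
    change μ[(C t ∩ D t).indicator 1 | ℱ t] =ᵐ[μ] _
    rw [Set.inter_comm, ← Set.indicator_indicator]
    exact condExp_indicator ((integrable_const 1).indicator (ℱ.le _ _ (hC t))) (hD t)
  filter_upwards [ae_mem_limsup_atTop_iff μ hG, ae_all_iff.2 hcond, ae_all_iff.2 h]
    with ω hω hcondω hrω hinf
  rw [← mem_limsup_iff_frequently_mem, Set.limsup_eq_tendsto_sum_indicator_atTop hr] at hinf
  have hmem : ∃ᶠ t in atTop, ω ∈ G t := by
    rw [← mem_limsup_iff_frequently_mem, hω]
    refine tendsto_atTop_mono (fun N => Finset.sum_le_sum fun t _ => ?_) hinf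
    rw [hcondω]
    exact Set.indicator_le_indicator (hrω t)
  rwa [← map_add_atTop_eq_nat 1, frequently_map] at hmem

end BorelCantelli

namespace RandomSchedule

variable {n : ℕ} {Ω : Type} [mΩ : MeasurableSpace Ω] {μ : Measure Ω} (S : RandomSchedule μ n)
  (P : Protocol) (F : Fin n → Frame) (σ : Fin n → ℝ) (p₀ : Config n)

/-- The random configuration at time `t` of the robots under the schedule `S`. -/
abbrev config (t : ℕ) (ω : Ω) : Config n :=
  run P F σ p₀ (fun s => S.act s ω) (fun s => S.coin s ω) t

theorem measurableSet_config (t : ℕ) (U : Set (Config n)) :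
    MeasurableSet[S.past t] {ω | S.config P F σ p₀ t ω ∈ U} := by
  induction t generalizing U with
  | zero => exact @MeasurableSet.const _ (S.past 0) (p₀ ∈ U)
  | succ t ih =>
    have hle : S.past t ≤ S.past (t + 1) := S.past.mono (Nat.le_succ t)
    have hsplit : {ω | S.config P F σ p₀ (t + 1) ω ∈ U} =
        ⋃ (a : Finset (Fin n)) (c : Fin n → Fin 2), {ω | S.act t ω = a} ∩ {ω | S.coin t ω = c} ∩
          {ω | S.config P F σ p₀ t ω ∈ {p | step P F σ a c p ∈ U}} := by
      ext ω
      simp [run]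
    rw [hsplit]
    exact MeasurableSet.iUnion fun a => MeasurableSet.iUnion fun c =>
      ((hle _ (S.act_measurable t a)).inter (S.coin_measurable t c)).inter (hle _ (ih _))

theorem measurableSet_config_act (t : ℕ) (B : Config n → Finset (Fin n) → Prop) :
    MeasurableSet[S.past t] {ω | B (S.config P F σ p₀ t ω) (S.act t ω)} := by
  have hsplit : {ω | B (S.config P F σ p₀ t ω) (S.act t ω)} =
      ⋃ a, {ω | S.act t ω = a} ∩ {ω | S.config P F σ p₀ t ω ∈ {p | B p a}} := by
    ext ω
    simp
  rw [hsplit]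
  exact MeasurableSet.iUnion fun a =>
    (S.act_measurable t a).inter (S.measurableSet_config P F σ p₀ t _)

variable {t : ℕ} {c : Ω → Fin n → Fin 2}

theorem measurableSet_coin_eq (hc : ∀ a, MeasurableSet[S.past t] {ω | c ω = a}) :
    MeasurableSet[S.past (t + 1)] {ω | S.coin t ω = c ω} := by
  have hsplit : {ω | S.coin t ω = c ω} = ⋃ a, {ω | S.coin t ω = a} ∩ {ω | c ω = a} := by
    ext ω
    simp [eq_comm]
  rw [hsplit]
  exact MeasurableSet.iUnion fun a =>
    (S.coin_measurable t a).inter (S.past.mono (Nat.le_succ t) _ (hc a))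

theorem measure_coin_eq_inter (hc : ∀ a, MeasurableSet[S.past t] {ω | c ω = a})
    {E : Set Ω} (hE : MeasurableSet[S.past t] E) :
    μ ({ω | S.coin t ω = c ω} ∩ E) = (2⁻¹ : ENNReal) ^ n * μ E := by
  have hcE : ∀ a, MeasurableSet[S.past t] ({ω | c ω = a} ∩ E) := fun a => (hc a).inter hE
  have hsplit : {ω | S.coin t ω = c ω} ∩ E =
      ⋃ a, {ω | S.coin t ω = a} ∩ ({ω | c ω = a} ∩ E) := by
    ext ω
    simp [eq_comm]
  have hsplitE : E = ⋃ a, {ω | c ω = a} ∩ E := by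
    ext ω
    simp
  have hdisj : Pairwise (Function.onFun Disjoint fun a => {ω | c ω = a} ∩ E) := fun a b hab =>
    Set.disjoint_left.2 fun ω ha hb => hab (ha.1.symm.trans hb.1)
  rw [hsplit, measure_iUnion (fun a b hab => (hdisj hab).mono Set.inter_subset_right
    Set.inter_subset_right) fun a =>
      (S.past.le _ _ (S.coin_measurable t a)).inter (S.past.le _ _ (hcE a))]
  conv_rhs => rw [hsplitE, measure_iUnion hdisj fun a => S.past.le _ _ (hcE a),
    ← ENNReal.tsum_mul_left]
  exact tsum_congr fun a => S.coin_uniform t a _ (hcE a)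

theorem ae_frequently_of_exists_coin [IsFiniteMeasure μ]
    (G : Config n → Finset (Fin n) → (Fin n → Fin 2) → Prop) : ∀ᵐ ω ∂μ,
      (∃ᶠ t in atTop, ∃ c, G (S.config P F σ p₀ t ω) (S.act t ω) c) →
        ∃ᶠ t in atTop, G (S.config P F σ p₀ t ω) (S.act t ω) (S.coin t ω) := by
  have hex : ∀ p a, ∃ c, (∃ c, G p a c) → G p a c := fun p a => by
    by_cases h : ∃ c, G p a c
    · exact h.imp fun c hc _ => hc
    · exact ⟨0, fun h' => absurd h' h⟩
  choose c hc using hex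
  have hpred : ∀ t a, MeasurableSet[S.past t] {ω | c (S.config P F σ p₀ t ω) (S.act t ω) = a} :=
    fun t a => S.measurableSet_config_act P F σ p₀ t fun p b => c p b = a
  have hcond : ∀ t, ∀ᵐ ω ∂μ, ((2⁻¹ : ENNReal) ^ n).toReal ≤
      (μ[{ω | S.coin t ω = c (S.config P F σ p₀ t ω) (S.act t ω)}.indicator (1 : Ω → ℝ) |
        S.past t]) ω := fun t =>
    (condExp_indicator_one_ae_eq_const (S.past.le t)
      (S.past.le _ _ (S.measurableSet_coin_eq (hpred t)))
      fun E hE => S.measure_coin_eq_inter (hpred t) hE).mono fun ω hω => hω.ge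
  filter_upwards [ae_frequently_mem_inter_of_le_condExp (by simp)
    (fun t => S.measurableSet_coin_eq (hpred t))
    (fun t => S.measurableSet_config_act P F σ p₀ t fun p a => ∃ c, G p a c) hcond] with ω hω hinf
  refine (hω hinf).mono fun t ht => ?_
  obtain ⟨hcoin, hG⟩ := ht
  rw [show S.coin t ω = _ from hcoin]
  exact hc _ _ hG

theorem ae_eventually_forall_coin_not_lt [IsFiniteMeasure μ] {α : Type*} [PartialOrder α]
    [WellFoundedLT α] (Φ : Config n → α) : ∀ᵐ ω ∂μ,
      (∀ᶠ t in atTop, Φ (S.config P F σ p₀ (t + 1) ω) ≤ Φ (S.config P F σ p₀ t ω)) →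
        ∀ᶠ t in atTop, ∀ c,
          ¬ Φ (step P F σ (S.act t ω) c (S.config P F σ p₀ t ω)) < Φ (S.config P F σ p₀ t ω) := by
  filter_upwards [S.ae_frequently_of_exists_coin P F σ p₀
    fun p a c => Φ (step P F σ a c p) < Φ p] with ω hω hle
  by_contra hnot
  simp only [not_eventually, not_forall, not_not] at hnot
  obtain ⟨t, hlt, heq⟩ := ((hω hnot).and_eventually (eventually_succ_eq_of_eventually_succ_le
    (Φ := fun t => Φ (S.config P F σ p₀ t ω)) hle)).exists
  exact hlt.ne heq

end RandomSchedule

/-! ### Scattering -/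

section Voronoi

variable {S : Finset Plane} {p p' q : Plane}

theorem voronoiCell_mem_nhds (S : Finset Plane) (p : Plane) : voronoiCell S p ∈ nhds p := by
  change ∀ᶠ q in nhds p, ∀ p' ∈ S, p' ≠ p → dist q p < dist q p'
  refine (eventually_all_finset S).2 fun p' _ => eventually_imp_distrib_left.2 fun hne => ?_
  refine ContinuousAt.eventually_lt (by fun_prop) (by fun_prop) ?_
  rw [dist_self]
  exact dist_pos.2 hne.symm

theorem exists_isCellChoice : ∃ c, IsCellChoice c :=
  Classical.skolem.1 fun v : View =>
    ((eventually_nhdsWithin_of_eventually_nhds (voronoiCell_mem_nhds v.occupied 0)).and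
      eventually_mem_nhdsWithin).exists (f := nhdsWithin (0 : Plane) {0}ᶜ)

theorem mem_voronoiCell_of_wbtw {z : Plane} (hq : q ∈ voronoiCell S p) (h : Wbtw ℝ p z q) :
    z ∈ voronoiCell S p := fun p' hp' hne => by
  have hd := h.dist_add_dist
  have htri := dist_triangle p' z q
  have hlt := hq p' hp' hne
  rw [dist_comm z p, dist_comm z p']
  rw [dist_comm q p, dist_comm q p'] at hlt
  linarith

theorem eq_of_mem_voronoiCell (hp : p ∈ S) (hp' : p' ∈ S) (h : q ∈ voronoiCell S p)
    (h' : q ∈ voronoiCell S p') : p = p' := by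
  by_contra hne
  exact lt_asymm (h p' hp' (Ne.symm hne)) (h' p hp hne)

open Classical in
theorem toGlobal_mem_voronoiCell {n : ℕ} (F : Frame) (p : Config n) (i : Fin n) {x : Plane}
    (hx : x ∈ voronoiCell (view F p i).occupied 0) :
    F.toGlobal (p i) x ∈ voronoiCell (Finset.univ.image p) (p i) := by
  simp only [voronoiCell, Set.mem_ofPred_eq, mem_occupied, forall_exists_index,
    forall_apply_eq_imp_iff, Finset.mem_image, Finset.mem_univ, true_and] at hx ⊢
  intro j hne
  have hlt := hx j
  rw [← F.toLocal_self (p i), (F.toLocal_injective (p i)).ne_iff, ← F.toLocal_toGlobal (p i) x,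
    F.dist_toLocal, F.dist_toLocal] at hlt
  exact lt_of_mul_lt_mul_left (hlt hne) (inv_pos.2 F.unit_pos).le

end Voronoi

section Scatter

variable {n : ℕ} {c : View → Plane} {F : Fin n → Frame} {σ : Fin n → ℝ} {act : Finset (Fin n)}
  {coin : Fin n → Fin 2} {p : Config n}

open Classical in
theorem IsCellChoice.step_mem_voronoiCell (hc : IsCellChoice c) (hσ : ∀ i, 0 < σ i) (i : Fin n) :
    step (procSP c) F σ act coin p i ∈ voronoiCell (Finset.univ.image p) (p i) := by
  have hself := mem_of_mem_nhds (voronoiCell_mem_nhds (Finset.univ.image p) (p i))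
  unfold step procSP
  split_ifs
  · exact mem_voronoiCell_of_wbtw (toGlobal_mem_voronoiCell (F i) p i (hc _).1)
      (wbtw_moveToward (hσ i) _ _)
  · rwa [Frame.toGlobal_zero, moveToward_self (hσ i).le]
  · exact hself

theorem IsCellChoice.eq_of_step_eq (hc : IsCellChoice c) (hσ : ∀ i, 0 < σ i) {i j : Fin n}
    (h : step (procSP c) F σ act coin p i = step (procSP c) F σ act coin p j) : p i = p j := by
  classical
  exact eq_of_mem_voronoiCell (S := Finset.univ.image p) (by simp) (by simp)
    (hc.step_mem_voronoiCell hσ i) (h ▸ hc.step_mem_voronoiCell hσ j)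

open Classical in
/-- The ordered pairs of robots at the same position. -/
def coincidences (p : Config n) : Finset (Fin n × Fin n) :=
  Finset.univ.filter fun x => p x.1 = p x.2

theorem IsCellChoice.coincidences_step_subset (hc : IsCellChoice c) (hσ : ∀ i, 0 < σ i) :
    coincidences (step (procSP c) F σ act coin p) ⊆ coincidences p :=
  Finset.monotone_filter_right _ fun _ _ => hc.eq_of_step_eq hσ

theorem IsCellChoice.exists_step_ne (hc : IsCellChoice c) (hσ : ∀ i, 0 < σ i) {i j : Fin n}
    (hi : i ∈ act) (hj : j ≠ i) (hij : p j = p i) :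
    ∃ coin, step (procSP c) F σ act coin p i ≠ step (procSP c) F σ act coin p j := by
  refine ⟨Function.update 1 i 0, ?_⟩
  have hstay : step (procSP c) F σ act (Function.update 1 i 0) p j = p i := by
    simp [step, procSP, hj, hij, Frame.toGlobal_zero, moveToward_self (hσ j).le]
  rw [hstay]
  simp only [step, procSP, hi, Function.update_self, if_true]
  rw [Ne, moveToward_eq_left_iff (hσ i)]
  intro h
  refine (hc (view (F i) p i)).2 ((F i).toLocal_toGlobal (p i) _ |>.symm.trans ?_)
  rw [← h, (F i).toLocal_self]

theorem IsCellChoice.exists_coincidences_step_ssubset (hc : IsCellChoice c) (hσ : ∀ i, 0 < σ i)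
    {i j : Fin n} (hi : i ∈ act) (hj : j ≠ i) (hij : p j = p i) :
    ∃ coin, coincidences (step (procSP c) F σ act coin p) ⊂ coincidences p := by
  obtain ⟨coin, hne⟩ := hc.exists_step_ne (F := F) hσ hi hj hij
  exact ⟨coin, (Finset.ssubset_iff_of_subset (hc.coincidences_step_subset hσ)).2
    ⟨(i, j), by simp [coincidences, hij], by simpa [coincidences] using hne⟩⟩

theorem step_procSSAGP_of_nontrivial (A : DetAlgorithm) (h : (multiplePoints p).Nontrivial) :
    step (procSSAGP c A) F σ act coin p = step (procSP c) F σ act coin p := by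
  funext i
  simp only [step, procSSAGP, if_pos ((two_le_card_multiple (F i) p i).2 h)]

theorem step_procSSAGP_of_not_nontrivial (A : DetAlgorithm)
    (h : ¬ (multiplePoints p).Nontrivial) :
    step (procSSAGP c A) F σ act coin p = step A.toProtocol F σ act coin p := by
  funext i
  simp only [step, procSSAGP, if_neg (mt (two_le_card_multiple (F i) p i).1 h),
    DetAlgorithm.toProtocol]

theorem IsCellChoice.ae_exists_not_nontrivial (hc : IsCellChoice c) (hσ : ∀ i, 0 < σ i)
    {Ω : Type} [MeasurableSpace Ω] {μ : Measure Ω} [IsProbabilityMeasure μ]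
    (S : RandomSchedule μ n) (A : DetAlgorithm) (p₀ : Config n) :
    ∀ᵐ ω ∂μ, ∃ t, ¬ (multiplePoints (S.config (procSSAGP c A) F σ p₀ t ω)).Nontrivial := by
  filter_upwards [S.act_fair, S.ae_eventually_forall_coin_not_lt (procSSAGP c A) F σ p₀
    coincidences] with ω hfair hdec
  by_contra! hmult
  have hstep : ∀ t coin, step (procSSAGP c A) F σ (S.act t ω) coin (S.config _ F σ p₀ t ω) =
      step (procSP c) F σ (S.act t ω) coin (S.config (procSSAGP c A) F σ p₀ t ω) :=
    fun t coin => step_procSSAGP_of_nontrivial A (hmult t)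
  have hshared : ∃ᶠ t in atTop, ∃ i ∈ S.act t ω, ∃ j ≠ i,
      S.config (procSSAGP c A) F σ p₀ t ω j = S.config (procSSAGP c A) F σ p₀ t ω i :=
    hfair.frequently_exists_active_eq (fun t i hi => if_neg hi) <|
      Eventually.frequently <| Eventually.of_forall fun t hinj =>
        (multiplePoints_eq_empty.2 hinj ▸ hmult t).ne_empty rfl
  obtain ⟨t, ⟨i, hi, j, hj, hij⟩, hnot⟩ := (hshared.and_eventually (hdec
    (Eventually.of_forall fun t => (congrArg coincidences (hstep t _)).trans_le
      (hc.coincidences_step_subset hσ)))).exists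
  obtain ⟨coin, hlt⟩ := hc.exists_coincidences_step_ssubset (F := F) hσ hi hj hij
  exact hnot coin (hstep t coin ▸ hlt)

theorem procSSAGP_selfStabilizing (hc : IsCellChoice c) (hn : 3 ≤ n) :
    SelfStabilizingGathering n (procSSAGP c gatherAlg) := by
  intro F σ hσ p₀ Ω _ μ _ S
  filter_upwards [S.act_fair, hc.ae_exists_not_nontrivial (F := F) hσ S gatherAlg p₀]
    with ω hfair hexit
  refine ⟨?_, fun t x hx i => ?_⟩
  · obtain ⟨x, hx⟩ := exists_eventually_gatheredAt_of_run hn hσ hfair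
      (coin := fun t => S.coin t ω) (fun t => step_procSSAGP_of_not_nontrivial gatherAlg) hexit
    exact (eventually_atTop.1 hx).imp fun T hT => ⟨x, hT⟩
  · have hpole := hx.isPole (by omega)
    rw [run, step_procSSAGP_of_not_nontrivial gatherAlg hpole.not_nontrivial,
      hpole.step_gatherAlg hσ]
    exact approachStep_eq_of_eq hσ (hx i)

end Scatter

/-! ### Two robots -/

section Pair

variable {F : Fin 2 → Frame} {σ : Fin 2 → ℝ} {act : Finset (Fin 2)} {coin : Fin 2 → Fin 2}
  {p : Config 2}

theorem dist_rev_eq (p : Config 2) (i : Fin 2) : dist (p i) (p i.rev) = dist (p 0) (p 1) := by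
  fin_cases i
  · rfl
  · exact dist_comm _ _

theorem toGlobal_otherPosition (F : Frame) (p : Config 2) (i : Fin 2) :
    F.toGlobal (p i) (otherPosition (view F p i)) = p i.rev := by
  have hzero : ∀ j, F.toLocal (p i) (p j) = 0 ↔ p j = p i := fun j =>
    ⟨fun h => F.toLocal_injective (p i) (h.trans (F.toLocal_self _).symm),
      fun h => by rw [h, F.toLocal_self]⟩
  unfold otherPosition
  split_ifs with h
  · obtain ⟨hx, h0⟩ := h.choose_spec
    obtain ⟨j, hj⟩ := (mem_occupied F p i).1 hx
    rw [← hj, Ne, hzero] at h0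
    rw [← hj, F.toGlobal_toLocal]
    exact congrArg p (by grind)
  · push Not at h
    rw [F.toGlobal_zero]
    exact ((hzero _).1 (h _ ((mem_occupied F p i).2 ⟨i.rev, rfl⟩))).symm

theorem step_procPair (hσ : ∀ i, 0 < σ i) (i : Fin 2) :
    step procPair F σ act coin p i =
      if i ∈ act ∧ coin i = 0 then moveToward (σ i) (p i) (p i.rev) else p i := by
  by_cases hi : i ∈ act <;> by_cases h0 : coin i = 0 <;>
    simp [step, procPair, hi, h0, toGlobal_otherPosition, Frame.toGlobal_zero,
      moveToward_self (hσ i).le]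

theorem step_procPair_mem_segment (hσ : ∀ i, 0 < σ i) (i : Fin 2) :
    step procPair F σ act coin p i ∈ segment ℝ (p i) (p i.rev) := by
  rw [step_procPair hσ]
  split_ifs
  · exact mem_segment_iff_wbtw.2 (wbtw_moveToward (hσ i) _ _)
  · exact left_mem_segment ℝ _ _

theorem GatheredAt.step_procPair (hσ : ∀ i, 0 < σ i) {x : Plane} (h : GatheredAt p x) :
    GatheredAt (step procPair F σ act coin p) x := fun i => by
  have hmem := step_procPair_mem_segment (F := F) (act := act) (coin := coin) (p := p) hσ i
  rwa [h i, h i.rev, segment_same] at hmem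

theorem dist_step_procPair_le (hσ : ∀ i, 0 < σ i) :
    dist (step procPair F σ act coin p 0) (step procPair F σ act coin p 1) ≤
      dist (p 0) (p 1) := by
  have hmem : ∀ i, step procPair F σ act coin p i ∈ segment ℝ (p 0) (p 1) :=
    Fin.forall_fin_two.2 ⟨step_procPair_mem_segment hσ 0,
      segment_symm ℝ (p 1) (p 0) ▸ step_procPair_mem_segment hσ 1⟩
  simp only [← convexHull_pair] at hmem
  refine (Metric.dist_le_diam_of_mem ?_ (hmem 0) (hmem 1)).trans_eq ?_
  · exact isBounded_convexHull.2 (Set.toFinite _).isBounded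
  · rw [convexHull_diam, Metric.diam_pair]

theorem exists_dist_step_procPair_eq (hσ : ∀ i, 0 < σ i) {i : Fin 2} (hi : i ∈ act) :
    ∃ coin, dist (step procPair F σ act coin p 0) (step procPair F σ act coin p 1) =
      max (dist (p 0) (p 1) - σ i) 0 := by
  have hrev : i.rev ≠ i := by grind
  refine ⟨Function.update 1 i 0, ?_⟩
  have hmove : step procPair F σ act (Function.update 1 i 0) p i =
      moveToward (σ i) (p i) (p i.rev) := by
    rw [step_procPair hσ, if_pos ⟨hi, Function.update_self ..⟩]
  have hstay : step procPair F σ act (Function.update 1 i 0) p i.rev = p i.rev := by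
    rw [step_procPair hσ, if_neg]
    simp [hrev]
  rw [← dist_rev_eq _ i, hmove, hstay, dist_moveToward (hσ i), dist_rev_eq]

/-- An upper bound on the number of moves after which two robots meet if one of them moves at a
time. -/
def pairWorkload (σ : Fin 2 → ℝ) (p : Config 2) : ℕ := ⌈dist (p 0) (p 1) / min (σ 0) (σ 1)⌉₊

theorem pairWorkload_step_procPair_le (hσ : ∀ i, 0 < σ i) :
    pairWorkload σ (step procPair F σ act coin p) ≤ pairWorkload σ p :=
  Nat.ceil_mono (div_le_div_of_nonneg_right (dist_step_procPair_le hσ)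
    (lt_min (hσ 0) (hσ 1)).le)

theorem exists_pairWorkload_step_procPair_lt (hσ : ∀ i, 0 < σ i) (hact : act.Nonempty)
    (hp : p 0 ≠ p 1) :
    ∃ coin, pairWorkload σ (step procPair F σ act coin p) < pairWorkload σ p := by
  obtain ⟨i, hi⟩ := hact
  have hmin : 0 < min (σ 0) (σ 1) := lt_min (hσ 0) (hσ 1)
  have hle : ∀ i, min (σ 0) (σ 1) ≤ σ i :=
    Fin.forall_fin_two.2 ⟨min_le_left _ _, min_le_right _ _⟩
  obtain ⟨coin, hdist⟩ := exists_dist_step_procPair_eq (F := F) (p := p) hσ hi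
  refine ⟨coin, (Nat.ceil_mono (div_le_div_of_nonneg_right ?_ hmin.le)).trans_lt
    (ceil_max_sub_div_lt hmin (dist_pos.2 hp))⟩
  rw [hdist]
  exact max_le_max_right 0 (sub_le_sub_left (hle i) _)

theorem procPair_selfStabilizing : SelfStabilizingGathering 2 procPair := by
  intro F σ hσ p₀ Ω _ μ _ S
  filter_upwards [S.ae_eventually_forall_coin_not_lt procPair F σ p₀ (pairWorkload σ)] with ω hdec
  have hclosed : ∀ t x, GatheredAt (S.config procPair F σ p₀ t ω) x →
      GatheredAt (S.config procPair F σ p₀ (t + 1) ω) x := fun _ _ h => h.step_procPair hσ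
  refine ⟨?_, hclosed⟩
  obtain ⟨T, hT⟩ := (hdec (Eventually.of_forall fun _ => pairWorkload_step_procPair_le hσ)).exists
  have hmeet : S.config procPair F σ p₀ T ω 0 = S.config procPair F σ p₀ T ω 1 := by
    by_contra hne
    obtain ⟨coin, hlt⟩ := exists_pairWorkload_step_procPair_lt (F := F) hσ (S.act_nonempty T ω) hne
    exact hT coin hlt
  refine ⟨T, S.config procPair F σ p₀ T ω 1, fun t ht => ?_⟩
  induction t, ht using Nat.le_induction with
  | base => exact Fin.forall_fin_two.2 ⟨hmeet, rfl⟩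
  | succ t _ ih => exact hclosed t _ ih

end Pair

/-! ### The protocol -/

/-- The protocol: the routine for two robots if two robots are at distinct positions, and
`SSA_GP` otherwise. -/
def gatherProtocol (c : View → Plane) : Protocol := fun v r =>
  if v.occupied.card = 2 ∧ v.multiple = ∅ then procPair v r else procSSAGP c gatherAlg v r

theorem card_occupied_of_injective {n : ℕ} (F : Frame) {p : Config n} (hp : Function.Injective p)
    (i : Fin n) : (view F p i).occupied.card = n :=
  (Finset.card_image_of_injective _ ((F.toLocal_injective (p i)).comp hp)).trans
    (Finset.card_fin n)

theorem gatherProtocol_sameBehaviour_procSSAGP (c : View → Plane) {n : ℕ} (hn : n ≠ 2) :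
    SameBehaviour n (gatherProtocol c) (procSSAGP c gatherAlg) := by
  intro F p i r
  refine if_neg ?_
  rintro ⟨hcard, hempty⟩
  rw [multiple_eq_empty, multiplePoints_eq_empty] at hempty
  exact hn ((card_occupied_of_injective F hempty i).symm.trans hcard)

theorem GatheredAt.gatherAlg_view_eq_zero {n : ℕ} {p : Config n} {x : Plane} (hn : 2 ≤ n)
    (h : GatheredAt p x) (F : Frame) (i : Fin n) : gatherAlg (view F p i) = 0 := by
  rw [← F.toLocal_toGlobal (p i) (gatherAlg _), (h.isPole hn).toGlobal_gatherAlg, h i, ite_self,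
    F.toLocal_self]

theorem GatheredAt.otherPosition_view_eq_zero {p : Config 2} {x : Plane} (h : GatheredAt p x)
    (F : Frame) (i : Fin 2) : otherPosition (view F p i) = 0 := by
  rw [← F.toLocal_toGlobal (p i) (otherPosition _), toGlobal_otherPosition, h, h, F.toLocal_self]

theorem gatherProtocol_sameBehaviour_procPair (c : View → Plane) :
    SameBehaviour 2 (gatherProtocol c) procPair := by
  intro F p i r
  by_cases hp : p 0 = p 1
  · have hg : GatheredAt p (p 1) := Fin.forall_fin_two.2 ⟨hp, rfl⟩
    have hpole := hg.isPole le_rfl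
    have hempty : (view F p i).multiple ≠ ∅ := fun h =>
      Fin.zero_ne_one (multiplePoints_eq_empty.1 ((multiple_eq_empty F p i).1 h) hp)
    rw [gatherProtocol, if_neg fun h => hempty h.2, procSSAGP,
      if_neg (mt (two_le_card_multiple F p i).1 hpole.not_nontrivial),
      hg.gatherAlg_view_eq_zero le_rfl, procPair, hg.otherPosition_view_eq_zero, ite_self]
  · have hinj : Function.Injective p := by
      intro j k hjk
      grind
    exact if_pos ⟨card_occupied_of_injective F hinj i,
      (multiple_eq_empty F p i).2 (multiplePoints_eq_empty.2 hinj)⟩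

theorem SameBehaviour.run_eq {n : ℕ} {P Q : Protocol} (h : SameBehaviour n P Q)
    (F : Fin n → Frame) (σ : Fin n → ℝ) (p₀ : Config n) (act : ℕ → Finset (Fin n))
    (coin : ℕ → Fin n → Fin 2) : run P F σ p₀ act coin = run Q F σ p₀ act coin := by
  funext t
  induction t with
  | zero => rfl
  | succ t ih =>
    funext i
    simp only [run, step, ih, h (F i) _ i]

theorem SameBehaviour.selfStabilizingGathering {n : ℕ} {P Q : Protocol} (h : SameBehaviour n P Q)
    (hQ : SelfStabilizingGathering n Q) : SelfStabilizingGathering n P := by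
  intro F σ hσ p₀ Ω _ μ _ S
  simp only [h.run_eq]
  exact hQ F σ hσ p₀ Ω μ S

end

end Robots

theorem theorem4 :
    ∃ P : Robots.Protocol,
      (∀ n : ℕ, 2 ≤ n → Robots.SelfStabilizingGathering n P) ∧
      Robots.SameBehaviour 2 P Robots.procPair ∧
      ∃ (c : Robots.View → Robots.Plane) (A : Robots.DetAlgorithm),
        Robots.IsCellChoice c ∧
        (∀ n : ℕ, 3 ≤ n → Robots.DetGatheringFromDistinct n A) ∧
        (∀ n : ℕ, 3 ≤ n → Robots.SameBehaviour n P (Robots.procSSAGP c A)) := by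
  obtain ⟨c, hc⟩ := Robots.exists_isCellChoice
  refine ⟨Robots.gatherProtocol c, fun n hn => ?_, Robots.gatherProtocol_sameBehaviour_procPair c,
    c, Robots.gatherAlg, hc, fun n hn => Robots.gatherAlg_detGatheringFromDistinct hn,
    fun n hn => Robots.gatherProtocol_sameBehaviour_procSSAGP c (by omega)⟩
  rcases hn.eq_or_lt with rfl | hn
  · exact (Robots.gatherProtocol_sameBehaviour_procPair c).selfStabilizingGathering
      Robots.procPair_selfStabilizing
  · exact (Robots.gatherProtocol_sameBehaviour_procSSAGP c (by omega)).selfStabilizingGathering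
      (Robots.procSSAGP_selfStabilizing hc hn)
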